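/- **Covariance of adjoint forms.** Let $\mathbb{E}$ be a field of characteristic zero, and let $X$ and $Y$ be separated integral schemes of finite type over $\mathbb{E}$, both of dimension $l$. Let $m\ge 0$ be an integer. Let $\Omega_{X,rat}^m := (\Omega_{\mathbb{E}(X)\mid\mathbb{E}}^{\wedge l})^{\otimes m}$ be the $\mathbb{E}(X)$-vector space of rational $m$-fold $l$-forms on $X$, considered also as a constant sheaf on $X$. A *divisorial valuation ring* of $\mathbb{E}(X)$ over $\mathbb{E}$ is a discrete valuation ring $(A,\mathfrak{m})$ of rank one with $\mathbb{E}\subseteq A\subset\mathbb{E}(X)$, with fraction field $\mathbb{E}(X)$, and such that $A/\mathfrak{m}$ has transcendence degree $l-1$ over $\mathbb{E}$. Let $\widehat{A}$ be its $\mathfrak m$-adic completion and $\mathcal{Q}(\widehat A)$ the fraction field of $\widehat A$. A *formal prime divisor* on $X$ is given by such a ring $A$ together with an extension of the natural morphism $\operatorname{Spec}\mathcal{Q}(\widehat A)\to\operatorname{Spec}\mathbb{E}(X)\to X$ to a morphism $\varphi:\operatorname{Spec}\widehat{A}\to X$; its *center* is the image of the closed point. A form $\eta\in\Omega_{X,rat}^m$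 is *regular at $\varphi$* if its image $\varphi^\#(\eta)$ in $\mathcal{Q}(\widehat A)\otimes_A(\Omega_{A\mid\mathbb{E}}^{\wedge l})^{\otimes m}=\mathcal{Q}(\widehat A)\otimes_{\mathbb{E}(X)}\Omega_{X,rat}^m$ lies in the image of $\widehat{A}\otimes_A(\Omega_{A\mid\mathbb{E}}^{\wedge l})^{\otimes m}$. The *sheaf of $m$-adjoint forms* $\Omega_{X,adj}^m\subseteq\Omega_{X,rat}^m$ is the subsheaf $$U\mapsto\{\eta\in\Omega_{X,rat}^m \mid \eta \text{ is regular at all formal prime divisors on } X \text{ centered in } U\}.$$ Define $\Omega_{Y,rat}^m$ and $\Omega_{Y,adj}^m$ in the same way. Let $\pi:Y\to X$ be a proper, birational morphism over $\mathbb{E}$. Then the induced map $\pi^\#:\Omega_{X,rat}^m\to\Omega_{Y,rat}^m$ is bijective, and, identifying $\Omega_{X,rat}^m$ with $\Omega_{Y,rat}^m$ by means of $\pi^\#$, $$\pi_*(\Omega_{Y,adj}^m)=\Omega_{X,adj}^m$$ as subsheaves of $\Omega_{X,rat}^m$; that is, for every open $U\subseteq X$ and every $\eta\in\Omega_{X,rat}^m$,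 one has $\eta\in\Gamma(U,\Omega_{X,adj}^m)$ if and only if $\pi^\#(\eta)\in\Gamma(\pi^{-1}(U),\Omega_{Y,adj}^m)$. -/

import Mathlib

open AlgebraicGeometry CategoryTheory TopologicalSpace
open scoped TensorProduct

universe u

noncomputable section

namespace AdjointForms

/-! ### Tensor powers of exterior powers -/

section Forms

/-- `(M^{∧ l})^{⊗ m}`: the `m`-th tensor power of the `l`-th exterior power of an `R`-module. -/
abbrev TensorForms (R : Type*) [CommRing R] (M : Type*) [AddCommGroup M] [Module R M]
    (l m : ℕ) : Type _ :=
  ⨂[R] (_ : Fin m), ⋀[R]^l M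

variable {R S M N : Type*} [CommRing R] [CommRing S] [Algebra R S]
  [AddCommGroup M] [Module R M] [AddCommGroup N] [Module R N] [Module S N] [IsScalarTower R S N]

/-- The map `⋀^l_R M → ⋀^l_S N`, `x₁ ∧ ⋯ ∧ x_l ↦ f x₁ ∧ ⋯ ∧ f x_l`, induced by an `R`-linear map
`f : M → N` into an `S`-module, where `S` is an `R`-algebra. -/
def wedgeMap (l : ℕ) (f : M →ₗ[R] N) : ⋀[R]^l M →ₗ[R] ⋀[S]^l N :=
  exteriorPower.alternatingMapLinearEquiv
    (AlternatingMap.compLinearMap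
      { ((exteriorPower.ιMulti S l (M := N)).toMultilinearMap.restrictScalars R) with
        map_eq_zero_of_eq' := (exteriorPower.ιMulti S l (M := N)).map_eq_zero_of_eq' } f)

/-- The map `(⋀^l_R M)^{⊗ m} → (⋀^l_S N)^{⊗ m}` induced by an `R`-linear map `f : M → N` into an
`S`-module, where `S` is an `R`-algebra. -/
def tensorFormsMap (l m : ℕ) (f : M →ₗ[R] N) : TensorForms R M l m →ₗ[R] TensorForms S N l m :=
  PiTensorProduct.lift
    (((PiTensorProduct.tprod S (s := fun _ : Fin m ↦ ⋀[S]^l N)).restrictScalars R).compLinearMap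
      fun _ ↦ wedgeMap l f)

lemma wedgeMap_ιMulti (l : ℕ) (f : M →ₗ[R] N) (x : Fin l → M) :
    wedgeMap (S := S) l f (exteriorPower.ιMulti R l x) =
      exteriorPower.ιMulti S l (fun i ↦ f (x i)) := by
  simp [wedgeMap]
  rfl

lemma tensorFormsMap_tprod (l m : ℕ) (f : M →ₗ[R] N) (x : Fin m → ⋀[R]^l M) :
    tensorFormsMap (S := S) l m f (PiTensorProduct.tprod R x) =
      PiTensorProduct.tprod S (fun i ↦ wedgeMap (S := S) l f (x i)) := by
  simp [tensorFormsMap]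

end Forms

/-! ### Divisorial valuation rings and their completions -/

section Valuation

variable (E K : Type u) [Field E] [Field K] [Algebra E K] (l : ℕ)

/-- `(Ω_{K|E}^{∧ l})^{⊗ m}` for a field extension `K` of `E`. -/
abbrev FieldForms (m : ℕ) : Type u := TensorForms K (Ω[K⁄E]) l m

/-- A divisorial valuation ring of `K` over `E`: a discrete valuation ring `A` of rank one with
`E ⊆ A ⊆ K` and fraction field `K` whose residue field has transcendence degree `l - 1` over `E`. -/
structure DivisorialValuationRing where
  ring : Subalgebra E K
  isFractionRing : IsFractionRing ring K
  isDiscreteValuationRing : IsDiscreteValuationRing ring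
  trdeg_residueField : Algebra.trdeg E (IsLocalRing.ResidueField ring) + 1 = (l : Cardinal.{u})

variable {E K l}

namespace DivisorialValuationRing

variable (A : DivisorialValuationRing E K l)

instance : IsFractionRing A.ring K := A.isFractionRing

instance : IsDiscreteValuationRing A.ring := A.isDiscreteValuationRing

/-- The completion `Â` of `A` with respect to its maximal ideal. -/
abbrev Completion : Type u := AdicCompletion (IsLocalRing.maximalIdeal A.ring) A.ring

lemma algebraMap_mem_nonZeroDivisors (a : nonZeroDivisors A.ring) :
    algebraMap A.ring A.Completion a ∈ nonZeroDivisors A.Completion := by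
  rw [mem_nonZeroDivisors_iff_right]
  intro x hx
  refine Module.Flat.isSMulRegular_of_nonZeroDivisors (M := A.Completion) a.2 ?_
  simpa [Algebra.smul_def, mul_comm] using hx

/-- The ring of fractions `Q(Â)`, which is the fraction field of the domain `Â`. -/
def FracCompletion : Type u := FractionRing A.Completion

instance : CommRing A.FracCompletion := inferInstanceAs (CommRing (FractionRing A.Completion))

instance : Algebra A.Completion A.FracCompletion :=
  inferInstanceAs (Algebra A.Completion (FractionRing A.Completion))

instance : IsFractionRing A.Completion A.FracCompletion :=
  inferInstanceAs (IsFractionRing A.Completion (FractionRing A.Completion))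

lemma isUnit_algebraMap_fracCompletion (a : nonZeroDivisors A.ring) :
    IsUnit (((algebraMap A.Completion A.FracCompletion).comp
      (algebraMap A.ring A.Completion)) a) :=
  IsLocalization.map_units A.FracCompletion
    (⟨_, A.algebraMap_mem_nonZeroDivisors a⟩ : nonZeroDivisors A.Completion)

/-- The embedding `K → Q(Â)` extending `A → Â`. -/
def toFracCompletion : K →+* A.FracCompletion :=
  IsLocalization.lift (M := nonZeroDivisors A.ring) A.isUnit_algebraMap_fracCompletion

instance : Algebra K A.FracCompletion := A.toFracCompletion.toAlgebra

lemma algebraMap_fracCompletion (a : A.ring) :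
    algebraMap K A.FracCompletion (algebraMap A.ring K a) =
      algebraMap A.Completion A.FracCompletion (algebraMap A.ring A.Completion a) := by
  rw [RingHom.algebraMap_toAlgebra, toFracCompletion, IsLocalization.lift_eq]
  rfl

instance : IsScalarTower A.ring A.Completion A.FracCompletion :=
  IsScalarTower.of_algebraMap_eq fun a ↦ A.algebraMap_fracCompletion a

/-- `Ω̃_Â^m = Â ⊗_A (Ω_{A|E}^{∧ l})^{⊗ m}`. -/
abbrev CompletedForms (m : ℕ) : Type u :=
  A.Completion ⊗[A.ring] TensorForms A.ring (Ω[A.ring⁄E]) l m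

/-- `Ω̃_{Q(Â)}^m = Q(Â) ⊗_A (Ω_{A|E}^{∧ l})^{⊗ m}`, written as `Q(Â) ⊗_K (Ω_{K|E}^{∧ l})^{⊗ m}` by
means of the localization isomorphism `(Ω_{K|E}^{∧ l})^{⊗ m} = K ⊗_A (Ω_{A|E}^{∧ l})^{⊗ m}`. -/
abbrev FracCompletedForms (m : ℕ) : Type u :=
  A.FracCompletion ⊗[K] FieldForms E K l m

/-- The natural map `(Ω_{A|E}^{∧ l})^{⊗ m} → (Ω_{K|E}^{∧ l})^{⊗ m}`. -/
def formsToField (m : ℕ) :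
    TensorForms A.ring (Ω[A.ring⁄E]) l m →ₗ[A.ring] FieldForms E K l m :=
  tensorFormsMap l m (KaehlerDifferential.map E E A.ring K)

/-- The canonical inclusion `Ω̃_Â^m → Ω̃_{Q(Â)}^m`, `a ⊗ ω ↦ a ⊗ ω`. -/
def completedFormsInclusion (m : ℕ) :
    A.CompletedForms m →ₗ[A.ring] A.FracCompletedForms m :=
  TensorProduct.lift <| LinearMap.mk₂ A.ring
    (fun a ω ↦ algebraMap A.Completion A.FracCompletion a ⊗ₜ[K] A.formsToField m ω)
    (fun a b ω ↦ by rw [map_add, TensorProduct.add_tmul])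
    (fun c a ω ↦ by rw [algebra_compatible_smul A.Completion c a, smul_eq_mul, map_mul,
      ← A.algebraMap_fracCompletion, ← Algebra.smul_def, ← algebraMap_smul K c (_ ⊗ₜ[K] _),
      TensorProduct.smul_tmul'])
    (fun a ω η ↦ by rw [map_add, TensorProduct.tmul_add])
    (fun c a ω ↦ by
      rw [map_smul, ← algebraMap_smul K c, ← algebraMap_smul K c, TensorProduct.tmul_smul])

/-- The embedding `φ^# : (Ω_{K|E}^{∧ l})^{⊗ m} → Ω̃_{Q(Â)}^m` induced by `K → Q(Â)`. -/
def fieldFormsToFrac (m : ℕ) : FieldForms E K l m →ₗ[K] A.FracCompletedForms m :=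
  TensorProduct.mk K A.FracCompletion (FieldForms E K l m) 1

lemma completedFormsInclusion_smul (m : ℕ) (b : A.Completion) (x : A.CompletedForms m) :
    A.completedFormsInclusion m (b • x) =
      algebraMap A.Completion A.FracCompletion b • A.completedFormsInclusion m x := by
  induction x using TensorProduct.induction_on with
  | zero => simp
  | add x y hx hy => rw [smul_add, map_add, map_add, smul_add, hx, hy]
  | tmul a ω =>
    rw [TensorProduct.smul_tmul', smul_eq_mul]
    simp [completedFormsInclusion, TensorProduct.smul_tmul', Algebra.smul_def]

end DivisorialValuationRing

variable {L : Type u} [Field L] [Algebra E L]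

/-- The semilinear map `(Ω_{K|E}^{∧ l})^{⊗ m} → (Ω_{L|E}^{∧ l})^{⊗ m}` of differential forms induced
by an `E`-embedding of fields `σ : K → L` (with `d f ↦ d (σ f)`). -/
def FieldForms.map (l m : ℕ) (σ : K →ₐ[E] L) :
    FieldForms E K l m →ₛₗ[(σ : K →+* L)] FieldForms E L l m :=
  letI : Algebra K L := (σ : K →+* L).toAlgebra
  haveI : IsScalarTower E K L := IsScalarTower.of_algebraMap_eq fun x ↦ (σ.commutes x).symm
  { toFun := tensorFormsMap l m (KaehlerDifferential.map E E K L)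
    map_add' := map_add _
    map_smul' := fun c x ↦ by
      rw [map_smul, ← algebraMap_smul L c]
      rfl }

end Valuation

/-! ### Schemes over a field -/

section Schemes

variable (E : Type u) [Field E] (X : Scheme.{u}) [IsIntegral X] [X.Over (Spec (.of E))]

/-- The function field of an integral `E`-scheme as an extension of `E`. -/
instance functionFieldAlgebra : Algebra E X.functionField :=
  ((Scheme.ΓSpecIso (.of E)).inv ≫ (X ↘ Spec (.of E)).appTop ≫
    X.presheaf.germ ⊤ (genericPoint X) (Opens.mem_top _)).hom.toAlgebra

/-- `Ω_{X,rat}^m = (Ω_{E(X)|E}^{∧ l})^{⊗ m}`: the rational `m`-fold `l`-forms on `X`. -/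
abbrev RatForms (l m : ℕ) : Type u := FieldForms E X.functionField l m

/-- A formal prime divisor on `X`: a divisorial valuation ring `A` of `E(X)` over `E` and a morphism
`φ : Spec Â → X` representing the natural rational map `Spec Â ⤏ X`, i.e. whose restriction to the
generic point is the composite `Spec Q(Â) → Spec E(X) → X`. -/
structure FormalPrimeDivisor (l : ℕ) where
  valuationRing : DivisorialValuationRing E X.functionField l
  hom : Spec (.of valuationRing.Completion) ⟶ X
  generic_comp_hom :
    Spec.map (CommRingCat.ofHom
        (algebraMap valuationRing.Completion valuationRing.FracCompletion)) ≫ hom =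
      Spec.map (CommRingCat.ofHom valuationRing.toFracCompletion) ≫
        X.fromSpecStalk (genericPoint X)

variable {E X} {l m : ℕ}

/-- The center of `φ : Spec Â → X`: the image of the closed point. -/
def FormalPrimeDivisor.center (φ : FormalPrimeDivisor E X l) : X :=
  φ.hom (IsLocalRing.closedPoint φ.valuationRing.Completion)

/-- A rational form `η` is regular at `φ` if `φ^#(η)` lies in `Ω̃_Â^m`. -/
def IsRegularAt (η : RatForms E X l m) (φ : FormalPrimeDivisor E X l) : Prop :=
  φ.valuationRing.fieldFormsToFrac m η ∈
    LinearMap.range (φ.valuationRing.completedFormsInclusion m)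

lemma exists_completion_eq (φ : FormalPrimeDivisor E X l) (U : X.Opens) [Nonempty U]
    (hU : φ.center ∈ U) (a : Γ(X, U)) :
    ∃ b : φ.valuationRing.Completion,
      algebraMap φ.valuationRing.Completion φ.valuationRing.FracCompletion b =
        φ.valuationRing.toFracCompletion ((X.germToFunctionField U).hom a) := by
  have hle : (⊤ : (Spec (.of φ.valuationRing.Completion)).Opens) ≤ φ.hom ⁻¹ᵁ U :=
    ((IsLocalRing.closedPoint_mem_iff (φ.hom ⁻¹ᵁ U)).mp hU).ge
  refine ⟨(Scheme.ΓSpecIso _).hom (φ.hom.appLE U ⊤ hle a), ?_⟩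
  have key := φ.generic_comp_hom
  set i := CommRingCat.ofHom
    (algebraMap φ.valuationRing.Completion φ.valuationRing.FracCompletion) with hi
  set j : X.functionField ⟶ _ := CommRingCat.ofHom φ.valuationRing.toFracCompletion with hj
  have h1 : ∀ h, (Spec.map i ≫ φ.hom).appLE U ⊤ h =
      φ.hom.appLE U ⊤ hle ≫ (Spec.map i).appTop := fun h ↦
    (Scheme.Hom.appLE_comp_appLE (Spec.map i) φ.hom U ⊤ ⊤ hle le_top).symm.trans
      congr(φ.hom.appLE U ⊤ hle ≫ $((Spec.map i).appLE_eq_app (U := ⊤)))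
  have hU' : genericPoint X ∈ U :=
    ((genericPoint_spec X).mem_open_set_iff U.isOpen).mpr (by simpa using ‹Nonempty U›)
  have htop : (⊤ : (Spec X.functionField).Opens) ≤ X.fromSpecStalk (genericPoint X) ⁻¹ᵁ U := by
    refine ((IsLocalRing.closedPoint_mem_iff _).mp ?_).ge
    change X.fromSpecStalk (genericPoint X) (IsLocalRing.closedPoint _) ∈ U
    rwa [Scheme.fromSpecStalk_closedPoint]
  have h0 : (X.fromSpecStalk (genericPoint X)).appLE U ⊤ htop =
      X.germToFunctionField U ≫ (Scheme.ΓSpecIso _).inv := by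
    rw [Scheme.Hom.appLE, Scheme.fromSpecStalk_app hU', Category.assoc, Category.assoc,
      ← Functor.map_comp]
    refine congr(_ ≫ _ ≫ $((Spec X.functionField).presheaf.map_id _)).trans ?_
    rw [Category.comp_id]
  have h2 : ∀ h, (Spec.map j ≫ X.fromSpecStalk (genericPoint X)).appLE U ⊤ h =
      X.germToFunctionField U ≫ j ≫ (Scheme.ΓSpecIso _).inv := fun h ↦
    (Scheme.Hom.appLE_comp_appLE (Spec.map j) _ U ⊤ ⊤ htop le_top).symm.trans <|
      congr($h0 ≫ $((Spec.map j).appLE_eq_app (U := ⊤))).trans <| by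
        rw [Scheme.ΓSpecIso_inv_naturality j, Category.assoc]
        rfl
  have h3 : φ.hom.appLE U ⊤ hle ≫ (Scheme.ΓSpecIso _).hom ≫ i =
      X.germToFunctionField U ≫ j := by
    have hi' : (⊤ : (Spec (.of φ.valuationRing.FracCompletion)).Opens) ≤
        (Spec.map i ≫ φ.hom) ⁻¹ᵁ U := fun x _ ↦ hle (Opens.mem_top (Spec.map i x))
    have hj' : (⊤ : (Spec (.of φ.valuationRing.FracCompletion)).Opens) ≤
        (Spec.map j ≫ X.fromSpecStalk (genericPoint X)) ⁻¹ᵁ U :=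
      fun x _ ↦ htop (Opens.mem_top (Spec.map j x))
    have key' : (Spec.map i ≫ φ.hom).appLE U ⊤ hi' =
        (Spec.map j ≫ X.fromSpecStalk (genericPoint X)).appLE U ⊤ hj' := by
      congr 1
    rw [h1, h2] at key'
    rw [← Scheme.ΓSpecIso_naturality, reassoc_of% key']
    simp
  exact congr($(h3).hom a)

variable (E X l m) in
/-- A subsheaf (of `𝒪_X`-modules) of the constant sheaf `Ω_{X,rat}^m` on the irreducible space `X`.
It is given by the sets `sections U` of those rational forms which, as sections over `U` of the
constant sheaf, belong to the subsheaf. All nonempty opens have the same sections `Ω_{X,rat}^m` of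
the constant sheaf, and `sections ⊥` is everything, because the constant sheaf vanishes on `⊥`. -/
@[ext]
structure RatFormsSubsheaf where
  sections : X.Opens → AddSubgroup (RatForms E X l m)
  smul_mem : ∀ (U : X.Opens) [Nonempty U] (a : Γ(X, U)) (η : RatForms E X l m),
    η ∈ sections U → (X.germToFunctionField U).hom a • η ∈ sections U
  mono : ∀ U V : X.Opens, V ≤ U → sections U ≤ sections V
  glue : ∀ (S : Set X.Opens) (η : RatForms E X l m),
    (∀ U ∈ S, η ∈ sections U) → η ∈ sections (sSup S)

variable (E X l m) in
/-- The sheaf `Ω_{X,adj}^m` of `m`-adjoint forms: its sections over `U` are the rational forms which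
are regular at all formal prime divisors on `X` centered in `U`. -/
def adjointForms : RatFormsSubsheaf E X l m where
  sections U :=
    { carrier := {η | ∀ φ : FormalPrimeDivisor E X l, φ.center ∈ U → IsRegularAt η φ}
      zero_mem' := fun φ _ ↦ by simp [IsRegularAt]
      add_mem' := fun {η θ} hη hθ φ hφ ↦ by
        have := add_mem (hη φ hφ) (hθ φ hφ)
        rwa [← map_add] at this
      neg_mem' := fun {η} hη φ hφ ↦ by
        have := neg_mem (hη φ hφ)
        rwa [← map_neg] at this }
  smul_mem U _ a η hη φ hφ := by
    obtain ⟨b, hb⟩ := exists_completion_eq φ U hφ a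
    obtain ⟨x, hx⟩ := hη φ hφ
    refine ⟨b • x, ?_⟩
    rw [φ.valuationRing.completedFormsInclusion_smul, hx, hb, map_smul]
    exact algebraMap_smul _ _ _
  mono U V hVU η hη φ hφ := hη φ (hVU hφ)
  glue S η h φ hφ := by
    obtain ⟨U, hU, hφU⟩ := Opens.mem_sSup.mp hφ
    exact h U hU φ hφU

end Schemes

/-! ### Birational morphisms -/

section Birational

variable {E : Type u} [Field E] {X Y : Scheme.{u}} [IsIntegral X] [IsIntegral Y]

/-- A morphism is birational if, as a rational map, it is given by an isomorphism between dense open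
subschemes, i.e. if it has an inverse rational map. -/
class IsBirational (π : Y ⟶ X) : Prop where
  exists_partialIso : ∃ e : Y.PartialIso X, e.toRationalMap = π.toRationalMap

instance (priority := 100) IsBirational.isDominant (π : Y ⟶ X) [IsBirational π] :
    IsDominant π := by
  obtain ⟨e, he⟩ := IsBirational.exists_partialIso (π := π)
  have h1 : IsDominant e.toPartialMap.hom := by
    have := Opens.isDominant_ι e.dense_target
    exact inferInstanceAs (IsDominant (e.iso.hom ≫ e.target.ι))
  have h2 := (Scheme.PartialMap.isDominant_hom_iff_of_equiv _ _ (Quotient.exact he)).mp h1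
  exact IsDominant.of_comp Y.topIso.hom π (H := h2)

lemma map_genericPoint (π : Y ⟶ X) [IsDominant π] : π (genericPoint Y) = genericPoint X := by
  have h := (genericPoint_spec Y).image π.continuous
  rw [Set.image_univ, π.denseRange.closure_range] at h
  exact h.eq (genericPoint_spec X)

/-- The field extension `E(X) → E(Y)` induced by a dominant morphism `π : Y → X`. -/
def functionFieldMap (π : Y ⟶ X) [IsDominant π] : X.functionField ⟶ Y.functionField :=
  X.presheaf.stalkSpecializes (specializes_of_eq (map_genericPoint π)) ≫
    π.stalkMap (genericPoint Y)

lemma germ_functionFieldMap (π : Y ⟶ X) [IsDominant π] (U : X.Opens) [Nonempty U]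
    [Nonempty (π ⁻¹ᵁ U : Y.Opens)] :
    X.germToFunctionField U ≫ functionFieldMap π =
      π.app U ≫ Y.germToFunctionField (π ⁻¹ᵁ U) := by
  rw [functionFieldMap, TopCat.Presheaf.germ_stalkSpecializes_assoc, Scheme.Hom.germ_stalkMap]

variable [X.Over (Spec (.of E))] [Y.Over (Spec (.of E))]

variable (E) in
/-- The extension `E(X) → E(Y)` as a homomorphism of `E`-algebras. -/
def functionFieldAlgHom (π : Y ⟶ X) [IsDominant π] [π.IsOver (Spec (.of E))] :
    X.functionField →ₐ[E] Y.functionField :=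
  { (functionFieldMap π).hom with
    commutes' := fun x ↦ by
      have h : ((Scheme.ΓSpecIso (.of E)).inv ≫ (X ↘ Spec (.of E)).appTop ≫
          X.presheaf.germ ⊤ (genericPoint X) (Opens.mem_top _)) ≫ functionFieldMap π =
          (Scheme.ΓSpecIso (.of E)).inv ≫ (Y ↘ Spec (.of E)).appTop ≫
          Y.presheaf.germ ⊤ (genericPoint Y) (Opens.mem_top _) := by
        have hover : (Y ↘ Spec (.of E)).appTop = (X ↘ Spec (.of E)).appTop ≫ π.appTop := by
          rw [← Scheme.Hom.comp_appTop, comp_over]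
        have hgerm : X.presheaf.germ ⊤ (genericPoint X) (Opens.mem_top _) ≫ functionFieldMap π =
            π.appTop ≫ Y.presheaf.germ ⊤ (genericPoint Y) (Opens.mem_top _) := by
          rw [functionFieldMap, TopCat.Presheaf.germ_stalkSpecializes_assoc,
            Scheme.Hom.germ_stalkMap]
          rfl
        rw [hover, Category.assoc, Category.assoc, Category.assoc, hgerm]
      exact congr($(h).hom x) }

variable (E) in
/-- `π^# : Ω_{X,rat}^m → Ω_{Y,rat}^m`. -/
def ratPullback (π : Y ⟶ X) [IsDominant π] [π.IsOver (Spec (.of E))] (l m : ℕ) :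
    RatForms E X l m →+ RatForms E Y l m :=
  (FieldForms.map l m (functionFieldAlgHom E π)).toAddMonoidHom

/-- The direct image `π_* F` of a subsheaf `F` of `Ω_{Y,rat}^m`, viewed inside `Ω_{X,rat}^m` by means
of `π^#` : its sections over `U` are the `η` with `π^#(η)` in the sections of `F` over `π⁻¹ U`. -/
def RatFormsSubsheaf.pushforward {l m : ℕ} (F : RatFormsSubsheaf E Y l m) (π : Y ⟶ X)
    [IsDominant π] [π.IsOver (Spec (.of E))] : RatFormsSubsheaf E X l m where
  sections U := (F.sections (π ⁻¹ᵁ U)).comap (ratPullback E π l m)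
  smul_mem U _ a η hη := by
    have : Nonempty (π ⁻¹ᵁ U : Y.Opens) := ⟨⟨genericPoint Y, by
      change π (genericPoint Y) ∈ U
      rw [map_genericPoint]
      exact ((genericPoint_spec X).mem_open_set_iff U.isOpen).mpr
        (by simpa using ‹Nonempty U›)⟩⟩
    have h := F.smul_mem (π ⁻¹ᵁ U) (π.app U a) _ hη
    have e : (Y.germToFunctionField (π ⁻¹ᵁ U)).hom (π.app U a) =
        (functionFieldMap π).hom ((X.germToFunctionField U).hom a) :=
      congr($((germ_functionFieldMap π U).symm).hom a)
    rw [e] at h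
    have e2 := (FieldForms.map l m (functionFieldAlgHom E π)).map_smulₛₗ
      ((X.germToFunctionField U).hom a) η
    rw [AddSubgroup.mem_comap]
    exact (congrArg (· ∈ F.sections (π ⁻¹ᵁ U)) e2).mpr h
  mono U V hVU η hη := F.mono _ _ (π.preimage_mono hVU) hη
  glue S η h := by
    have h' := F.glue ((fun U ↦ π ⁻¹ᵁ U) '' S) (ratPullback E π l m η)
      (by rintro _ ⟨U, hU, rfl⟩; exact h U hU)
    refine F.mono _ _ (fun y hy ↦ ?_) h'
    obtain ⟨U, hU, hyU⟩ := Opens.mem_sSup.mp (show π y ∈ sSup S from hy)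
    exact Opens.mem_sSup.mpr ⟨_, ⟨U, hU, rfl⟩, hyU⟩

end Birational

end AdjointForms

end

/-! A birational `π` identifies the two function fields by an `E`-isomorphism `σ : E(X) ≃ E(Y)`, so
pulling back forms is bijective, with inverse induced by `σ⁻¹`. The same `σ` matches divisorial
valuation rings `A` of `E(X)` with their images `B` in `E(Y)`, together with completions, fraction
rings of completions, and lattices of integral forms. Regularity of `η` at a formal prime divisor
involves only the valuation ring, not the morphism to the scheme, so it is invariant under this
matching (`isRegularAt_ratPullback_iff`).

It remains to compare which valuation rings carry a formal prime divisor, and with which center. A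
morphism `Spec B̂ → Y` composed with `π` gives one to `X` (`FormalPrimeDivisor.exists_push`).
Conversely, `B̂` is a valuation ring with fraction field `Q(B̂)`, so the valuative criterion for the
proper `π` lifts `Spec B̂ ≅ Spec Â → X` to `Y` (`FormalPrimeDivisor.exists_lift`). In both cases `π`
sends the center on `Y` to the center on `X`; being centered in `U` thus means being centered in
`π⁻¹ U`, and both sheaves impose the same conditions. -/

noncomputable section

namespace AdjointForms

/-! ### Functoriality of tensor powers of exterior powers and of differentials -/

section Functoriality

variable {R S T M N P : Type*} [CommRing R] [CommRing S] [CommRing T] [Algebra R S] [Algebra R T]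
  [Algebra S T] [IsScalarTower R S T] [AddCommGroup M] [Module R M]
  [AddCommGroup N] [Module R N] [Module S N] [IsScalarTower R S N]
  [AddCommGroup P] [Module R P] [Module S P] [Module T P] [IsScalarTower R T P]
  [IsScalarTower S T P] [IsScalarTower R S P]

lemma wedgeMap_wedgeMap (l : ℕ) (f : M →ₗ[R] N) (g : N →ₗ[S] P) (x : ⋀[R]^l M) :
    wedgeMap (S := T) l g (wedgeMap (S := S) l f x) =
      wedgeMap (S := T) l (g.restrictScalars R ∘ₗ f) x := by
  have hx : x ∈ Submodule.span R (Set.range (exteriorPower.ιMulti R l (M := M))) := by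
    rw [exteriorPower.ιMulti_span]
    trivial
  induction hx using Submodule.span_induction with
  | mem x h =>
    obtain ⟨x, rfl⟩ := h
    simp only [wedgeMap_ιMulti]
    rfl
  | zero => simp
  | add x y _ _ hx hy => simp only [map_add, hx, hy]
  | smul r x _ hx => rw [map_smul, LinearMap.map_smul_of_tower, hx, map_smul]

lemma tensorFormsMap_tensorFormsMap (l m : ℕ) (f : M →ₗ[R] N) (g : N →ₗ[S] P)
    (x : TensorForms R M l m) :
    tensorFormsMap (S := T) l m g (tensorFormsMap (S := S) l m f x) =
      tensorFormsMap (S := T) l m (g.restrictScalars R ∘ₗ f) x := by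
  induction x using PiTensorProduct.induction_on with
  | smul_tprod r x =>
    rw [map_smul, LinearMap.map_smul_of_tower, map_smul]
    simp only [tensorFormsMap_tprod, wedgeMap_wedgeMap]
  | add x y hx hy => simp only [map_add, hx, hy]

lemma wedgeMap_id (l : ℕ) (x : ⋀[R]^l M) :
    wedgeMap (S := R) l (LinearMap.id : M →ₗ[R] M) x = x := by
  have hx : x ∈ Submodule.span R (Set.range (exteriorPower.ιMulti R l (M := M))) := by
    rw [exteriorPower.ιMulti_span]
    trivial
  induction hx using Submodule.span_induction with
  | mem x h =>
    obtain ⟨x, rfl⟩ := h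
    simp only [wedgeMap_ιMulti]
    rfl
  | zero => simp
  | add x y _ _ hx hy => simp only [map_add, hx, hy]
  | smul r x _ hx => rw [map_smul, hx]

lemma tensorFormsMap_id (l m : ℕ) (x : TensorForms R M l m) :
    tensorFormsMap (S := R) l m (LinearMap.id : M →ₗ[R] M) x = x := by
  induction x using PiTensorProduct.induction_on with
  | smul_tprod r x =>
    rw [map_smul]
    simp only [tensorFormsMap_tprod, wedgeMap_id]
  | add x y hx hy => simp only [map_add, hx, hy]

end Functoriality

lemma kaehlerMap_comp (E A B C : Type*) [CommRing E] [CommRing A] [CommRing B] [CommRing C]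
    [Algebra E A] [Algebra E B] [Algebra E C] [Algebra A B] [Algebra A C] [Algebra B C]
    [IsScalarTower E A B] [IsScalarTower E A C] [IsScalarTower E B C] [IsScalarTower A B C] :
    (KaehlerDifferential.map E E B C).restrictScalars A ∘ₗ KaehlerDifferential.map E E A B =
      KaehlerDifferential.map E E A C := by
  refine LinearMap.ext_on (KaehlerDifferential.span_range_derivation E A) ?_
  rintro _ ⟨x, rfl⟩
  simp [← IsScalarTower.algebraMap_apply]

/-- Both composites are induced by `A → L`. It is used for valuation rings `A`, `B` with fraction
fields `K`, `L`, to see that integral forms go to integral forms. -/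
lemma tensorFormsMap_kaehlerMap_comm (E A B K L : Type*) [CommRing E] [CommRing A] [CommRing B]
    [CommRing K] [CommRing L] [Algebra E A] [Algebra E B] [Algebra E K] [Algebra E L]
    [Algebra A B] [Algebra A K] [Algebra A L] [Algebra B L] [Algebra K L]
    [IsScalarTower E A B] [IsScalarTower E A K] [IsScalarTower E A L] [IsScalarTower E B L]
    [IsScalarTower E K L] [IsScalarTower A B L] [IsScalarTower A K L] (l m : ℕ)
    (ω : TensorForms A (Ω[A⁄E]) l m) :
    tensorFormsMap (S := L) l m (KaehlerDifferential.map E E B L)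
        (tensorFormsMap (S := B) l m (KaehlerDifferential.map E E A B) ω) =
      tensorFormsMap (S := L) l m (KaehlerDifferential.map E E K L)
        (tensorFormsMap (S := K) l m (KaehlerDifferential.map E E A K) ω) := by
  rw [tensorFormsMap_tensorFormsMap, tensorFormsMap_tensorFormsMap, kaehlerMap_comp,
    kaehlerMap_comp]

section FieldForms

variable {E K L : Type u} [Field E] [Field K] [Field L] [Algebra E K] [Algebra E L]

lemma FieldForms.map_symm_map (l m : ℕ) (σ : K ≃ₐ[E] L) (x : FieldForms E K l m) :
    FieldForms.map l m (σ.symm : L →ₐ[E] K) (FieldForms.map l m (σ : K →ₐ[E] L) x) = x := by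
  let : Algebra K L := ((σ : K →ₐ[E] L) : K →+* L).toAlgebra
  let : Algebra L K := ((σ.symm : L →ₐ[E] K) : L →+* K).toAlgebra
  have : IsScalarTower E K L := IsScalarTower.of_algebraMap_eq fun x ↦ (σ.commutes x).symm
  have : IsScalarTower E L K := IsScalarTower.of_algebraMap_eq fun x ↦ (σ.symm.commutes x).symm
  -- This tower encodes `σ⁻¹ ∘ σ = id`, so functoriality reduces the composite to the map induced by
  -- `K → K`.
  have : IsScalarTower K L K := IsScalarTower.of_algebraMap_eq fun x ↦ (σ.symm_apply_apply x).symm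
  refine (tensorFormsMap_tensorFormsMap l m (KaehlerDifferential.map E E K L)
    (KaehlerDifferential.map E E L K) x).trans ?_
  rw [kaehlerMap_comp]
  have : KaehlerDifferential.map E E K K = LinearMap.id := by
    refine LinearMap.ext_on (KaehlerDifferential.span_range_derivation E K) ?_
    rintro _ ⟨x, rfl⟩
    simp
  rw [this, tensorFormsMap_id]

lemma FieldForms.map_bijective (l m : ℕ) (σ : K ≃ₐ[E] L) :
    Function.Bijective (FieldForms.map l m (σ : K →ₐ[E] L)) :=
  Function.bijective_iff_has_inverse.mpr
    ⟨FieldForms.map l m (σ.symm : L →ₐ[E] K), FieldForms.map_symm_map l m σ,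
      FieldForms.map_symm_map l m σ.symm⟩

end FieldForms

end AdjointForms

end

noncomputable section

/-! ### Functoriality of adic completion -/

section AdicCompletionMap

variable {R S T : Type*} [CommRing R] [CommRing S] [CommRing T]

lemma pow_le_comap_pow {I : Ideal R} {J : Ideal S} {f : R →+* S} (h : I ≤ J.comap f) (n : ℕ) :
    I ^ n ≤ (J ^ n).comap f :=
  (Ideal.pow_right_mono h n).trans (Ideal.le_comap_pow f n)

/-- Compatibility with the transition maps, needed to assemble the maps into `S ⧸ J ^ n` into one
map to the inverse limit. -/
lemma factorPow_comp_quotientMap_comp_evalₐ {I : Ideal R} {J : Ideal S} {f : R →+* S}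
    (h : I ≤ J.comap f) {k n : ℕ} (hkn : k ≤ n) :
    (Ideal.Quotient.factorPow J hkn).comp
      ((Ideal.quotientMap (J ^ n) f (pow_le_comap_pow h n)).comp
        (AdicCompletion.evalₐ I n : AdicCompletion I R →+* R ⧸ I ^ n)) =
      (Ideal.quotientMap (J ^ k) f (pow_le_comap_pow h k)).comp
        (AdicCompletion.evalₐ I k : AdicCompletion I R →+* R ⧸ I ^ k) := by
  ext x
  obtain ⟨r, rfl⟩ := AdicCompletion.mk_surjective I R x
  have hr : Ideal.Quotient.mk (I ^ k) (r n) = Ideal.Quotient.mk (I ^ k) (r k) :=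
    AdicCompletion.Ideal.mk_eq_mk (I := I) hkn r
  have := congr(Ideal.quotientMap (J ^ k) f (pow_le_comap_pow h k) $hr)
  simpa using this

/-- The ring homomorphism between adic completions induced by a ring homomorphism mapping the
ideal `I` into the ideal `J`. -/
def adicCompletionMap (I : Ideal R) (J : Ideal S) (f : R →+* S) (h : I ≤ J.comap f) :
    AdicCompletion I R →+* AdicCompletion J S :=
  AdicCompletion.liftRingHom J
    (fun n ↦ (Ideal.quotientMap (J ^ n) f (pow_le_comap_pow h n)).comp
      (AdicCompletion.evalₐ I n : AdicCompletion I R →+* R ⧸ I ^ n))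
    (factorPow_comp_quotientMap_comp_evalₐ h)

lemma evalₐ_adicCompletionMap (I : Ideal R) (J : Ideal S) (f : R →+* S) (h : I ≤ J.comap f) (n : ℕ)
    (x : AdicCompletion I R) :
    AdicCompletion.evalₐ J n (adicCompletionMap I J f h x) =
      Ideal.quotientMap (J ^ n) f (pow_le_comap_pow h n) (AdicCompletion.evalₐ I n x) := by
  exact AdicCompletion.evalₐ_liftRingHom J _ (factorPow_comp_quotientMap_comp_evalₐ h) n x

lemma adicCompletionMap_algebraMap (I : Ideal R) (J : Ideal S) (f : R →+* S) (h : I ≤ J.comap f)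
    (r : R) :
    adicCompletionMap I J f h (algebraMap R _ r) = algebraMap S _ (f r) := by
  refine AdicCompletion.ext_evalₐ fun n ↦ ?_
  rw [evalₐ_adicCompletionMap, AlgHom.commutes, AlgHom.commutes]
  exact Ideal.quotientMap_mk

lemma adicCompletionMap_comp_apply (I : Ideal R) (J : Ideal S) (f : R →+* S) (h : I ≤ J.comap f)
    (g : S →+* R) (h' : J ≤ I.comap g) (hfg : ∀ r, g (f r) = r) (x : AdicCompletion I R) :
    adicCompletionMap J I g h' (adicCompletionMap I J f h x) = x := by
  refine AdicCompletion.ext_evalₐ fun n ↦ ?_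
  rw [evalₐ_adicCompletionMap, evalₐ_adicCompletionMap]
  obtain ⟨r, hr⟩ := Ideal.Quotient.mk_surjective (AdicCompletion.evalₐ I n x)
  rw [← hr, Ideal.quotientMap_mk, Ideal.quotientMap_mk, hfg]

end AdicCompletionMap

namespace AdjointForms

namespace DivisorialValuationRing

/-! ### Transport of valuation rings and regularity along field isomorphisms -/

section Transport

variable {E K L : Type u} [Field E] [Field K] [Field L] [Algebra E K] [Algebra E L] {l : ℕ}

/-- The image of a divisorial valuation ring under an isomorphism of fields. -/
def map (σ : K ≃ₐ[E] L) (A : DivisorialValuationRing E K l) : DivisorialValuationRing E L l :=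
  let e : A.ring ≃ₐ[E] A.ring.map (σ : K →ₐ[E] L) := σ.subalgebraMap A.ring
  have hD : IsDiscreteValuationRing (A.ring.map (σ : K →ₐ[E] L)) :=
    IsDiscreteValuationRing.RingEquivClass.isDiscreteValuationRing e
  { ring := A.ring.map (σ : K →ₐ[E] L)
    isFractionRing := by
      refine .of_field _ L fun z ↦ ?_
      obtain ⟨x, y, -, h⟩ := IsFractionRing.div_surjective (A := A.ring) (σ.symm z)
      refine ⟨e x, e y, ?_⟩
      rw [← σ.apply_symm_apply z, ← h, map_div₀]
      rfl
    isDiscreteValuationRing := hD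
    trdeg_residueField := by
      rw [← (IsLocalRing.ResidueField.mapAlgEquiv e).trdeg_eq]
      exact A.trdeg_residueField }

/-- The isomorphism between a divisorial valuation ring and its image under an isomorphism of
fields. -/
def mapEquiv (σ : K ≃ₐ[E] L) (A : DivisorialValuationRing E K l) : A.ring ≃ₐ[E] (A.map σ).ring :=
  σ.subalgebraMap A.ring

lemma coe_mapEquiv (σ : K ≃ₐ[E] L) (A : DivisorialValuationRing E K l) (a : A.ring) :
    (A.mapEquiv σ a : L) = σ a := rfl

variable {A : DivisorialValuationRing E K l} {B : DivisorialValuationRing E L l}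

lemma maximalIdeal_le_comap (e : A.ring ≃ₐ[E] B.ring) :
    IsLocalRing.maximalIdeal A.ring ≤
      (IsLocalRing.maximalIdeal B.ring).comap (e : A.ring →+* B.ring) := by
  intro x hx
  simpa using hx

/-- The isomorphism of completions induced by an isomorphism of divisorial valuation rings. -/
def completionEquiv (e : A.ring ≃ₐ[E] B.ring) : A.Completion ≃+* B.Completion :=
  .ofRingHom
    (adicCompletionMap _ _ (e : A.ring →+* B.ring) (maximalIdeal_le_comap e))
    (adicCompletionMap _ _ (e.symm : B.ring →+* A.ring) (maximalIdeal_le_comap e.symm))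
    (RingHom.ext fun x ↦ adicCompletionMap_comp_apply _ _ _ (maximalIdeal_le_comap e.symm) _ (maximalIdeal_le_comap e)
      e.apply_symm_apply x)
    (RingHom.ext fun x ↦ adicCompletionMap_comp_apply _ _ _ (maximalIdeal_le_comap e) _
      (maximalIdeal_le_comap e.symm) e.symm_apply_apply x)

lemma completionEquiv_algebraMap (e : A.ring ≃ₐ[E] B.ring) (a : A.ring) :
    completionEquiv e (algebraMap A.ring A.Completion a) =
      algebraMap B.ring B.Completion (e a) :=
  adicCompletionMap_algebraMap _ _ _ (maximalIdeal_le_comap e) a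

/-- The isomorphism `Q(Â) → Q(B̂)` induced by an isomorphism `A → B` of divisorial valuation
rings. -/
def fracCompletionEquiv (e : A.ring ≃ₐ[E] B.ring) : A.FracCompletion ≃+* B.FracCompletion :=
  IsFractionRing.ringEquivOfRingEquiv (completionEquiv e)

lemma fracCompletionEquiv_algebraMap (e : A.ring ≃ₐ[E] B.ring) (a : A.Completion) :
    fracCompletionEquiv e (algebraMap A.Completion A.FracCompletion a) =
      algebraMap B.Completion B.FracCompletion (completionEquiv e a) :=
  IsFractionRing.ringEquivOfRingEquiv_algebraMap _ _

/-- A ring homomorphism out of `K = Frac A` is determined on `A`, where both sides are `A → B → B̂ →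
Q(B̂)`. -/
lemma fracCompletionEquiv_toFracCompletion (σ : K ≃ₐ[E] L) (e : A.ring ≃ₐ[E] B.ring)
    (he : ∀ a, (e a : L) = σ a) (x : K) :
    fracCompletionEquiv e (A.toFracCompletion x) = B.toFracCompletion (σ x) := by
  suffices h : (fracCompletionEquiv e : A.FracCompletion →+* B.FracCompletion).comp
      A.toFracCompletion = B.toFracCompletion.comp (σ : K →+* L) from congr($h x)
  refine IsLocalization.ringHom_ext (nonZeroDivisors A.ring) (RingHom.ext fun a ↦ ?_)
  have h1 := A.algebraMap_fracCompletion a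
  have h2 := B.algebraMap_fracCompletion (e a)
  have h3 : algebraMap B.ring L (e a) = σ (algebraMap A.ring K a) := he a
  rw [RingHom.algebraMap_toAlgebra] at h1 h2
  rw [h3] at h2
  simp only [RingHom.comp_apply, RingHom.coe_coe]
  rw [h1, h2, fracCompletionEquiv_algebraMap, completionEquiv_algebraMap]

/-- The witness is the image under `A → B` of the given integral form; this is where `σ` preserves
the lattices that define regularity. -/
lemma map_formsToField (σ : K ≃ₐ[E] L) (e : A.ring ≃ₐ[E] B.ring) (he : ∀ a, (e a : L) = σ a)
    (m : ℕ) (ω : TensorForms A.ring (Ω[A.ring⁄E]) l m) :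
    ∃ ω', B.formsToField m ω' = FieldForms.map l m (σ : K →ₐ[E] L) (A.formsToField m ω) := by
  let : Algebra K L := ((σ : K →ₐ[E] L) : K →+* L).toAlgebra
  have : IsScalarTower E K L := IsScalarTower.of_algebraMap_eq fun x ↦ (σ.commutes x).symm
  let : Algebra A.ring B.ring := (e : A.ring →+* B.ring).toAlgebra
  have : IsScalarTower E A.ring B.ring :=
    IsScalarTower.of_algebraMap_eq fun x ↦ (e.commutes x).symm
  have : IsScalarTower A.ring K L := IsScalarTower.of_algebraMap_eq fun x ↦ rfl
  have : IsScalarTower A.ring B.ring L := IsScalarTower.of_algebraMap_eq fun x ↦ (he x).symm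
  have : IsScalarTower E A.ring L := IsScalarTower.of_algebraMap_eq fun x ↦ (σ.commutes x).symm
  refine ⟨tensorFormsMap l m (KaehlerDifferential.map E E A.ring B.ring) ω, ?_⟩
  exact tensorFormsMap_kaehlerMap_comm E A.ring B.ring K L l m ω

/-- The isomorphism `Q(Â) ⊗_K (Ω_{K|E}^{∧ l})^{⊗ m} → Q(B̂) ⊗_L (Ω_{L|E}^{∧ l})^{⊗ m}` of additive
groups induced by compatible isomorphisms `A → B` and `K → L`. -/
def fracCompletedFormsMap (σ : K ≃ₐ[E] L) (e : A.ring ≃ₐ[E] B.ring)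
    (he : ∀ a, (e a : L) = σ a) (m : ℕ) : A.FracCompletedForms m →+ B.FracCompletedForms m :=
  TensorProduct.liftAddHom
    (AddMonoidHom.mk' (fun x ↦
      (AddMonoidHom.mk' (fun η ↦
        (fracCompletionEquiv e x) ⊗ₜ[L] (FieldForms.map l m (σ : K →ₐ[E] L) η))
        fun η θ ↦ by rw [map_add, TensorProduct.tmul_add]))
      fun x y ↦ by
        ext η
        simp [TensorProduct.add_tmul])
    -- Balancing over `K`: on both factors `c` acts through `σ c`, which moves across the tensor
    -- product over `L`.
    fun c x η ↦ by
      have h1 : c • x = A.toFracCompletion c * x := Algebra.smul_def c x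
      have h2 (y : B.FracCompletion) : σ c • y = B.toFracCompletion (σ c) * y :=
        Algebra.smul_def (σ c) y
      have h3 : FieldForms.map l m (σ : K →ₐ[E] L) (c • η) =
          σ c • FieldForms.map l m (σ : K →ₐ[E] L) η := LinearMap.map_smulₛₗ _ _ _
      simp only [AddMonoidHom.mk'_apply]
      rw [h1, map_mul, fracCompletionEquiv_toFracCompletion σ e he, ← h2, h3,
        TensorProduct.smul_tmul]

lemma fracCompletedFormsMap_fieldFormsToFrac (σ : K ≃ₐ[E] L) (e : A.ring ≃ₐ[E] B.ring)
    (he : ∀ a, (e a : L) = σ a) (m : ℕ) (η : FieldForms E K l m) :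
    fracCompletedFormsMap σ e he m (A.fieldFormsToFrac m η) =
      B.fieldFormsToFrac m (FieldForms.map l m (σ : K →ₐ[E] L) η) := by
  simp [fracCompletedFormsMap, fieldFormsToFrac]

lemma fracCompletedFormsMap_mem_range (σ : K ≃ₐ[E] L) (e : A.ring ≃ₐ[E] B.ring)
    (he : ∀ a, (e a : L) = σ a) (m : ℕ) (x : A.CompletedForms m) :
    fracCompletedFormsMap σ e he m (A.completedFormsInclusion m x) ∈
      LinearMap.range (B.completedFormsInclusion m) := by
  induction x using TensorProduct.induction_on with
  | zero => simp
  | add x y hx hy =>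
    rw [map_add, map_add]
    exact add_mem hx hy
  | tmul a ω =>
    obtain ⟨ω', hω'⟩ := map_formsToField σ e he m ω
    refine ⟨completionEquiv e a ⊗ₜ ω', ?_⟩
    change _ ⊗ₜ[L] _ = fracCompletionEquiv e _ ⊗ₜ[L] _
    rw [hω', fracCompletionEquiv_algebraMap]

/-- Regularity of forms is invariant under isomorphisms of fields. -/
lemma fieldFormsToFrac_map_mem_range (σ : K ≃ₐ[E] L) (e : A.ring ≃ₐ[E] B.ring)
    (he : ∀ a, (e a : L) = σ a) (m : ℕ) {η : FieldForms E K l m}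
    (hη : A.fieldFormsToFrac m η ∈ LinearMap.range (A.completedFormsInclusion m)) :
    B.fieldFormsToFrac m (FieldForms.map l m (σ : K →ₐ[E] L) η) ∈
      LinearMap.range (B.completedFormsInclusion m) := by
  obtain ⟨x, hx⟩ := hη
  rw [← fracCompletedFormsMap_fieldFormsToFrac σ e he, ← hx]
  exact fracCompletedFormsMap_mem_range σ e he m x

end Transport

/-! ### The completion is a valuation ring -/

section ValuationRing

variable {E K : Type u} [Field E] [Field K] [Algebra E K] {l : ℕ}
  (A : DivisorialValuationRing E K l)

/-- The image of a uniformizer of `A` works: the maximal ideal of `Â` is extended from `A`, and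
nonzerodivisors of `A` stay nonzerodivisors in `Â`. -/
lemma exists_uniformizer : ∃ p ∈ nonZeroDivisors A.Completion,
    IsLocalRing.maximalIdeal A.Completion = Ideal.span {p} := by
  obtain ⟨p, hp⟩ := IsDiscreteValuationRing.exists_irreducible A.ring
  refine ⟨algebraMap _ _ p,
    A.algebraMap_mem_nonZeroDivisors ⟨p, mem_nonZeroDivisors_of_ne_zero hp.ne_zero⟩, ?_⟩
  have h : (IsLocalRing.maximalIdeal A.ring).map (algebraMap A.ring A.Completion) =
      (Ideal.span {p}).map (algebraMap A.ring A.Completion) :=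
    congr(Ideal.map _ $(hp.maximalIdeal_eq))
  rw [AdicCompletion.maximalIdeal_eq_map, h, Ideal.map_span, Set.image_singleton]

/-- Since `Â` is separated for its maximal ideal, a nonzero `x` lies in only finitely many powers of
it; dividing by the largest power of `p` leaves a unit. -/
lemma exists_eq_pow_mul_unit {p : A.Completion}
    (hp : IsLocalRing.maximalIdeal A.Completion = Ideal.span {p}) {x : A.Completion}
    (hx : x ≠ 0) : ∃ (n : ℕ) (u : A.Completionˣ), x = p ^ n * u := by
  classical
  have h : ∃ n, x ∉ IsLocalRing.maximalIdeal A.Completion ^ n := by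
    by_contra! h
    have hH : IsHausdorff (IsLocalRing.maximalIdeal A.Completion) A.Completion := inferInstance
    refine hx (hH.haus x fun n ↦ ?_)
    rw [SModEq.zero, smul_eq_mul, Ideal.mul_top]
    exact h n
  have hn := Nat.find_spec h
  -- The zeroth power is the whole ring, so the first power missing `x` has positive exponent; its
  -- predecessor `k` is the order of `x`.
  obtain ⟨k, hk⟩ : ∃ k, Nat.find h = k + 1 := by
    refine Nat.exists_eq_succ_of_ne_zero fun h0 ↦ ?_
    rw [h0] at hn
    simp at hn
  have hmem : x ∈ IsLocalRing.maximalIdeal A.Completion ^ k := by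
    simpa using Nat.find_min h (m := k) (by omega)
  rw [hk] at hn
  rw [hp, Ideal.span_singleton_pow, Ideal.mem_span_singleton] at hmem hn
  obtain ⟨y, rfl⟩ := hmem
  have hy : IsUnit y := by
    by_contra hy
    have : y ∈ IsLocalRing.maximalIdeal A.Completion := hy
    rw [hp, Ideal.mem_span_singleton] at this
    exact hn (by rw [pow_succ]; exact mul_dvd_mul_left _ this)
  exact ⟨k, hy.unit, rfl⟩

instance : IsDomain A.Completion := by
  obtain ⟨p, hp0, hp⟩ := A.exists_uniformizer
  have : NoZeroDivisors A.Completion := ⟨fun {x y} hxy ↦ by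
    by_contra! h
    obtain ⟨n, u, rfl⟩ := A.exists_eq_pow_mul_unit hp h.1
    obtain ⟨k, v, rfl⟩ := A.exists_eq_pow_mul_unit hp h.2
    -- Every nonzero element is a power of the nonzerodivisor `p` times a unit, so a product of two
    -- such is again a nonzerodivisor.
    have h0 : p ^ n * u * (p ^ k * v) ∈ nonZeroDivisors A.Completion :=
      mul_mem (mul_mem (pow_mem hp0 n) u.isUnit.mem_nonZeroDivisors)
        (mul_mem (pow_mem hp0 k) v.isUnit.mem_nonZeroDivisors)
    exact nonZeroDivisors.ne_zero h0 hxy⟩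
  exact NoZeroDivisors.to_isDomain _

instance : ValuationRing A.Completion := by
  obtain ⟨p, -, hp⟩ := A.exists_uniformizer
  refine ValuationRing.iff_dvd_total.mpr ⟨fun x y ↦ ?_⟩
  rcases eq_or_ne x 0 with rfl | hx
  · exact .inr (dvd_zero y)
  rcases eq_or_ne y 0 with rfl | hy
  · exact .inl (dvd_zero x)
  obtain ⟨n, u, rfl⟩ := A.exists_eq_pow_mul_unit hp hx
  obtain ⟨k, v, rfl⟩ := A.exists_eq_pow_mul_unit hp hy
  simp only [Units.mul_right_dvd, Units.dvd_mul_right]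
  exact (le_total n k).imp (pow_dvd_pow p) (pow_dvd_pow p)

end ValuationRing

end DivisorialValuationRing

end AdjointForms

end

noncomputable section

namespace AdjointForms

/-! ### Birational morphisms and function fields -/

section Birational

/-- On some dense open `W`, which contains the generic point, `π` agrees with a partial isomorphism.
There it is an open immersion, hence an isomorphism on stalks. -/
lemma isIso_stalkMap_genericPoint {X Y : Scheme.{u}} [IsIntegral Y] (π : Y ⟶ X) [IsBirational π] :
    IsIso (π.stalkMap (genericPoint Y)) := by
  obtain ⟨e, he⟩ := IsBirational.exists_partialIso (π := π)
  obtain ⟨W, hW, hWl, hWr, h⟩ := Scheme.PartialMap.toRationalMap_eq_iff.mp he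
  have hWs : W ≤ e.source := hWl
  have htop : Y.homOfLE (le_top : W ≤ ⊤) ≫ (⊤ : Y.Opens).ι = W.ι := Y.homOfLE_ι _
  have h' : Y.homOfLE hWs ≫ e.iso.hom ≫ e.target.ι = W.ι ≫ π := by
    rw [← htop, Category.assoc]
    exact h
  have : IsOpenImmersion (W.ι ≫ π) := by
    rw [← h']
    infer_instance
  have hmem : genericPoint Y ∈ W :=
    ((genericPoint_spec Y).mem_open_set_iff W.isOpen).mpr (by
      obtain ⟨y, hy⟩ := hW.nonempty
      exact ⟨y, trivial, hy⟩)
  let y : W.toScheme := ⟨genericPoint Y, hmem⟩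
  have h1 : IsIso ((W.ι ≫ π).stalkMap y) := inferInstance
  rw [Scheme.Hom.stalkMap_comp] at h1
  exact @IsIso.of_isIso_comp_right _ _ _ _ _ (π.stalkMap (W.ι y)) (W.ι.stalkMap y) inferInstance h1

variable {X Y : Scheme.{u}} [IsIntegral X] [IsIntegral Y]

instance isIso_functionFieldMap (π : Y ⟶ X) [IsBirational π] : IsIso (functionFieldMap π) := by
  have := isIso_stalkMap_genericPoint π
  have : IsIso (X.presheaf.stalkSpecializes (specializes_of_eq (map_genericPoint π))) :=
    (X.presheaf.stalkCongr (.of_eq (map_genericPoint π).symm)).isIso_hom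
  rw [functionFieldMap]
  infer_instance

/-- Translates the condition on the generic point in `FormalPrimeDivisor` between `X` and `Y`. -/
lemma SpecMap_functionFieldMap_fromSpecStalk (π : Y ⟶ X) [IsDominant π] :
    Spec.map (functionFieldMap π) ≫ X.fromSpecStalk (genericPoint X) =
      Y.fromSpecStalk (genericPoint Y) ≫ π := by
  rw [functionFieldMap, Spec.map_comp, Category.assoc,
    Scheme.SpecMap_stalkSpecializes_fromSpecStalk, Scheme.SpecMap_stalkMap_fromSpecStalk]

variable (E : Type u) [Field E] [X.Over (Spec (.of E))] [Y.Over (Spec (.of E))]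

/-- The isomorphism `E(X) → E(Y)` induced by a birational morphism `π : Y → X`. -/
def functionFieldAlgEquiv (π : Y ⟶ X) [IsBirational π] [π.IsOver (Spec (.of E))] :
    X.functionField ≃ₐ[E] Y.functionField :=
  .ofBijective (functionFieldAlgHom E π)
    (ConcreteCategory.bijective_of_isIso (functionFieldMap π))

lemma SpecMap_functionFieldAlgEquiv_fromSpecStalk (π : Y ⟶ X) [IsBirational π]
    [π.IsOver (Spec (.of E))] :
    Spec.map (CommRingCat.ofHom
      (functionFieldAlgEquiv E π : X.functionField →+* Y.functionField)) ≫
        X.fromSpecStalk (genericPoint X) = Y.fromSpecStalk (genericPoint Y) ≫ π :=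
  SpecMap_functionFieldMap_fromSpecStalk π

end Birational

/-! ### Formal prime divisors on `X` and on `Y` -/

section FormalPrimeDivisor

variable {E : Type u} [Field E] {X Y : Scheme.{u}} [IsIntegral X] [IsIntegral Y]
  [X.Over (Spec (.of E))] [Y.Over (Spec (.of E))] {l m : ℕ}

open DivisorialValuationRing

lemma closedPoint_completionEquiv {A : DivisorialValuationRing E X.functionField l}
    {B : DivisorialValuationRing E Y.functionField l} (e : A.ring ≃ₐ[E] B.ring) :
    Spec.map (CommRingCat.ofHom (completionEquiv e : A.Completion →+* B.Completion))
      (IsLocalRing.closedPoint B.Completion) = IsLocalRing.closedPoint A.Completion := by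
  have : IsLocalHom (completionEquiv e : A.Completion →+* B.Completion) := inferInstance
  exact IsLocalRing.comap_closedPoint (completionEquiv e : A.Completion →+* B.Completion)

/-- Formal prime divisors on `Y` push forward along birational morphisms `π : Y → X`. -/
lemma FormalPrimeDivisor.exists_push (π : Y ⟶ X) [IsBirational π] [π.IsOver (Spec (.of E))]
    (ψ : FormalPrimeDivisor E Y l) :
    ∃ (φ : FormalPrimeDivisor E X l) (e : φ.valuationRing.ring ≃ₐ[E] ψ.valuationRing.ring),
      (∀ a, (e a : Y.functionField) = functionFieldAlgEquiv E π a) ∧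
        φ.center = π ψ.center := by
  set σ := functionFieldAlgEquiv E π
  let B := ψ.valuationRing
  let A := B.map σ.symm
  let e : A.ring ≃ₐ[E] B.ring := (B.mapEquiv σ.symm).symm
  have he : ∀ a, (e a : Y.functionField) = σ a := fun a ↦ by
    have h := B.coe_mapEquiv σ.symm (e a)
    rw [← σ.symm_apply_eq, ← h, AlgEquiv.apply_symm_apply]
  have h1 : CommRingCat.ofHom (completionEquiv e.symm : B.Completion →+* A.Completion) ≫
      CommRingCat.ofHom (algebraMap A.Completion A.FracCompletion) =
      CommRingCat.ofHom (algebraMap B.Completion B.FracCompletion) ≫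
        CommRingCat.ofHom (fracCompletionEquiv e.symm : B.FracCompletion →+* A.FracCompletion) := by
    ext x
    exact (fracCompletionEquiv_algebraMap e.symm x).symm
  have h2 : CommRingCat.ofHom (A.toFracCompletion) =
      CommRingCat.ofHom (σ : X.functionField →+* Y.functionField) ≫
        CommRingCat.ofHom B.toFracCompletion ≫
        CommRingCat.ofHom (fracCompletionEquiv e.symm : B.FracCompletion →+* A.FracCompletion) := by
    ext x
    have h := fracCompletionEquiv_toFracCompletion σ.symm e.symm (fun b ↦ rfl) (σ x)
    rw [σ.symm_apply_apply] at h
    exact h.symm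
  -- The morphism is `Spec Â ≅ Spec B̂ → Y → X`. The first map preserves the closed point, which
  -- gives the statement on centers.
  refine ⟨⟨A, Spec.map (CommRingCat.ofHom
    (completionEquiv e.symm : B.Completion →+* A.Completion)) ≫ ψ.hom ≫ π, ?_⟩, e, he, ?_⟩
  · rw [← Spec.map_comp_assoc, h1, Spec.map_comp_assoc, reassoc_of% ψ.generic_comp_hom,
      ← SpecMap_functionFieldAlgEquiv_fromSpecStalk E π, h2, Spec.map_comp, Spec.map_comp]
    simp only [Category.assoc]
  · change π (ψ.hom (Spec.map _ _)) = _
    rw [closedPoint_completionEquiv e.symm]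
    rfl

/-- Formal prime divisors on `X` lift along proper birational morphisms `π : Y → X`. -/
lemma FormalPrimeDivisor.exists_lift (π : Y ⟶ X) [IsBirational π] [IsProper π]
    [π.IsOver (Spec (.of E))] (φ : FormalPrimeDivisor E X l) :
    ∃ (ψ : FormalPrimeDivisor E Y l) (e : φ.valuationRing.ring ≃ₐ[E] ψ.valuationRing.ring),
      (∀ a, (e a : Y.functionField) = functionFieldAlgEquiv E π a) ∧
        φ.center = π ψ.center := by
  set σ := functionFieldAlgEquiv E π
  let A := φ.valuationRing
  let B := A.map σ
  let e : A.ring ≃ₐ[E] B.ring := A.mapEquiv σ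
  have he : ∀ a, (e a : Y.functionField) = σ a := fun a ↦ rfl
  have h1 : CommRingCat.ofHom (completionEquiv e : A.Completion →+* B.Completion) ≫
      CommRingCat.ofHom (algebraMap B.Completion B.FracCompletion) =
      CommRingCat.ofHom (algebraMap A.Completion A.FracCompletion) ≫
        CommRingCat.ofHom (fracCompletionEquiv e : A.FracCompletion →+* B.FracCompletion) := by
    ext x
    exact (fracCompletionEquiv_algebraMap e x).symm
  have h2 : CommRingCat.ofHom (σ : X.functionField →+* Y.functionField) ≫
        CommRingCat.ofHom B.toFracCompletion =
      CommRingCat.ofHom (A.toFracCompletion) ≫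
        CommRingCat.ofHom (fracCompletionEquiv e : A.FracCompletion →+* B.FracCompletion) := by
    ext x
    exact (fracCompletionEquiv_toFracCompletion σ e he x).symm
  -- The square for the valuative criterion: `Spec Q(B̂) → Spec E(Y) → Y` above, `Spec B̂ ≅ Spec Â →
  -- X` below. It commutes by the generic condition on `φ` and compatibility of `σ` with `Q(Â) ≅
  -- Q(B̂)`.
  have sq : CommSq
      (Spec.map (CommRingCat.ofHom B.toFracCompletion) ≫ Y.fromSpecStalk (genericPoint Y))
      (Spec.map (CommRingCat.ofHom (algebraMap B.Completion B.FracCompletion))) π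
      (Spec.map (CommRingCat.ofHom (completionEquiv e : A.Completion →+* B.Completion)) ≫
        φ.hom) := by
    refine ⟨?_⟩
    rw [Category.assoc, ← SpecMap_functionFieldAlgEquiv_fromSpecStalk E π,
      ← Spec.map_comp_assoc, ← Spec.map_comp_assoc, h1]
    refine congr(Spec.map $h2 ≫ X.fromSpecStalk (genericPoint X)).trans ?_
    rw [Spec.map_comp_assoc, Spec.map_comp_assoc]
    exact congr(_ ≫ $(φ.generic_comp_hom.symm))
  let : Field B.FracCompletion := IsFractionRing.toField B.Completion
  have hex : ValuativeCriterion.Existence π := by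
    have h : (ValuativeCriterion ⊓ @QuasiCompact ⊓ @QuasiSeparated ⊓ @LocallyOfFiniteType) π :=
      IsProper.eq_valuativeCriterion ▸ ‹IsProper π›
    exact h.1.1.1.existence
  obtain ⟨⟨s, hs1, hs2⟩⟩ := (hex ⟨B.Completion, B.FracCompletion, _, _, sq⟩).exists_lift
  -- The upper triangle `hs1` is exactly the generic condition for `s` on `Y`; the lower triangle
  -- `hs2` yields the equality of centers.
  refine ⟨⟨B, s, hs1⟩, e, he, ?_⟩
  change φ.hom _ = (s ≫ π) (IsLocalRing.closedPoint B.Completion)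
  rw [hs2]
  change _ = φ.hom (Spec.map _ _)
  rw [closedPoint_completionEquiv e]

/-- Regularity of a form does not change if it is pulled back along a birational morphism. -/
lemma isRegularAt_ratPullback_iff (π : Y ⟶ X) [IsBirational π] [π.IsOver (Spec (.of E))]
    (φ : FormalPrimeDivisor E X l) (ψ : FormalPrimeDivisor E Y l)
    (e : φ.valuationRing.ring ≃ₐ[E] ψ.valuationRing.ring)
    (he : ∀ a, (e a : Y.functionField) = functionFieldAlgEquiv E π a) (η : RatForms E X l m) :
    IsRegularAt (ratPullback E π l m η) ψ ↔ IsRegularAt η φ := by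
  set σ := functionFieldAlgEquiv E π
  refine ⟨fun h ↦ ?_, fun h ↦ fieldFormsToFrac_map_mem_range σ e he m h⟩
  -- The converse is the same transport along `σ⁻¹`, which carries the pullback of `η` back to `η`.
  have he' : ∀ b, (e.symm b : X.functionField) = σ.symm b := fun b ↦ by
    rw [eq_comm, σ.symm_apply_eq, ← he, AlgEquiv.apply_symm_apply]
  have h' := fieldFormsToFrac_map_mem_range σ.symm e.symm he' m h
  have h2 : FieldForms.map l m (σ.symm : Y.functionField →ₐ[E] X.functionField)
      (ratPullback E π l m η) = η := FieldForms.map_symm_map l m σ η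
  rwa [h2] at h'

end FormalPrimeDivisor

end AdjointForms

end

theorem mainTheorem5 (E : Type u) [Field E] [CharZero E] (X Y : Scheme.{u})
    [X.Over (Spec (.of E))] [Y.Over (Spec (.of E))]
    [IsIntegral X] [IsSeparated (X ↘ Spec (.of E))]
    [LocallyOfFiniteType (X ↘ Spec (.of E))] [QuasiCompact (X ↘ Spec (.of E))]
    [IsIntegral Y] [IsSeparated (Y ↘ Spec (.of E))]
    [LocallyOfFiniteType (Y ↘ Spec (.of E))] [QuasiCompact (Y ↘ Spec (.of E))]
    (l : ℕ) (hX : topologicalKrullDim X = l) (hY : topologicalKrullDim Y = l)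
    (π : Y ⟶ X) [π.IsOver (Spec (.of E))] [IsProper π] [AdjointForms.IsBirational π] (m : ℕ) :
    Function.Bijective (AdjointForms.ratPullback E π l m) ∧
      (AdjointForms.adjointForms E Y l m).pushforward π = AdjointForms.adjointForms E X l m := by
  refine ⟨AdjointForms.FieldForms.map_bijective l m (AdjointForms.functionFieldAlgEquiv E π), ?_⟩
  ext U η
  -- A divisor on `X` centered in `U` is tested on its lift to `Y`; one on `Y` centered in `π⁻¹ U`
  -- is tested on its image on `X`.
  refine ⟨fun h φ hφ ↦ ?_, fun h ψ hψ ↦ ?_⟩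
  · obtain ⟨ψ, e, he, hc⟩ := AdjointForms.FormalPrimeDivisor.exists_lift π φ
    rw [hc] at hφ
    exact (AdjointForms.isRegularAt_ratPullback_iff π φ ψ e he η).mp (h ψ hφ)
  · obtain ⟨φ, e, he, hc⟩ := AdjointForms.FormalPrimeDivisor.exists_push π ψ
    refine (AdjointForms.isRegularAt_ratPullback_iff π φ ψ e he η).mpr (h φ ?_)
    rw [hc]
    exact hψ
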